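/- Let $\mathcal H$ be a complex Hilbert space and let $\bigwedge\mathcal H=\widehat\bigoplus_{n\ge 0}\bigwedge^n\mathcal H$ be its fermionic Fock space, i.e. the Hilbert space completion of the exterior algebra of $\mathcal H$ for the inner product with $\langle v_1\wedge\dots\wedge v_n, w_1\wedge\dots\wedge w_n\rangle=\det(\langle v_i,w_j\rangle)$ and with exterior powers of different degrees orthogonal. Let $T$ be a positive trace-class operator on $\mathcal H$. Then there is a unique bounded operator $\bigwedge T$ on $\bigwedge\mathcal H$ with $\bigwedge T(v_1\wedge\dots\wedge v_n)=Tv_1\wedge\dots\wedge Tv_n$ for all $n\ge 0$ and $v_1,\dots,v_n\in\mathcal H$. It is positive and of trace class, with $\mathrm{Tr}(\bigwedge T)\neq 0$, so that $\rho=\bigwedge T/\mathrm{Tr}(\bigwedge T)$ is a density matrix. The von Neumann entropy $S(\phi)=-\mathrm{Tr}(\rho\log\rho)$ of the state $\phi(a)=\mathrm{Tr}(\rho a)$ on the bounded operators on $\bigwedge\mathcal H$ is $$S(\phi)=\mathrm{Tr}(\mathcal E(T)),\qquad \mathcal E(x)=\log(1+x)-\frac{x\log x}{1+x}\quad(x>0),\qquad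 \mathcal E(0)=0,$$ as an equality in $[0,\infty]$, with the convention $0\log 0=0$. -/

import Mathlib

open scoped InnerProductSpace ENNReal ComplexConjugate

noncomputable section

namespace FermionicFock

section ExteriorPower

variable {H : Type*} [NormedAddCommGroup H] [InnerProductSpace ℂ H] {n : ℕ}

/-- The alternating map `v ↦ det ⟪w i, v j⟫`. -/
def gramAlt (w : Fin n → H) : H [⋀^Fin n]→ₗ[ℂ] ℂ :=
  Matrix.detRowAlternating.compLinearMap (LinearMap.pi fun i => innerₛₗ ℂ (w i))

/-- `v ↦ det ⟪w i, v j⟫`, as a linear form on the `n`-th exterior power. -/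
def gramLeft (w : Fin n → H) : ⋀[ℂ]^n H →ₗ[ℂ] ℂ :=
  exteriorPower.alternatingMapLinearEquiv (gramAlt w)

theorem gramLeft_ιMulti (w v : Fin n → H) :
    gramLeft w (exteriorPower.ιMulti ℂ n v) = Matrix.det (Matrix.of fun i j => ⟪w i, v j⟫_ℂ) := by
  rw [← Matrix.det_transpose]
  simp only [gramLeft, exteriorPower.alternatingMapLinearEquiv_apply_ιMulti]
  rfl

theorem gramLeft_conj (w v : Fin n → H) :
    conj (gramLeft w (exteriorPower.ιMulti ℂ n v)) = gramLeft v (exteriorPower.ιMulti ℂ n w) := by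
  rw [gramLeft_ιMulti, gramLeft_ιMulti, RingHom.map_det, ← Matrix.det_transpose]
  congr 1
  ext i j
  simp

theorem gramLeft_eq (w v : Fin n → H) :
    gramLeft w (exteriorPower.ιMulti ℂ n v) = conj (gramAlt v w) := by
  rw [← gramLeft_conj, gramLeft, exteriorPower.alternatingMapLinearEquiv_apply_ιMulti]

/-- For fixed `y`, the alternating map `w ↦ conj (gramLeft w y)`. -/
def gramRight (y : ⋀[ℂ]^n H) : H [⋀^Fin n]→ₗ[ℂ] ℂ where
  toFun w := conj (gramLeft w y)
  map_update_add' := by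
    intro inst w i a b
    have : gramLeft (Function.update w i (a + b)) =
        gramLeft (Function.update w i a) + gramLeft (Function.update w i b) := by
      refine exteriorPower.linearMap_ext (AlternatingMap.ext fun v => ?_)
      simp only [LinearMap.compAlternatingMap_apply, LinearMap.add_apply, gramLeft_eq,
        AlternatingMap.map_update_add, map_add]
    rw [this, LinearMap.add_apply, map_add]
  map_update_smul' := by
    intro inst w i c a
    have : gramLeft (Function.update w i (c • a)) = conj c • gramLeft (Function.update w i a) := by
      refine exteriorPower.linearMap_ext (AlternatingMap.ext fun v => ?_)
      simp only [LinearMap.compAlternatingMap_apply, LinearMap.smul_apply, gramLeft_eq,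
        AlternatingMap.map_update_smul, smul_eq_mul, map_mul]
    rw [this, LinearMap.smul_apply, smul_eq_mul, map_mul, Complex.conj_conj, smul_eq_mul]
  map_eq_zero_of_eq' := by
    intro w i j hij hne
    have : gramLeft w = 0 := by
      refine exteriorPower.linearMap_ext (AlternatingMap.ext fun v => ?_)
      simp only [LinearMap.compAlternatingMap_apply, gramLeft_eq]
      rw [AlternatingMap.map_eq_zero_of_eq _ w hij hne]
      simp
    simp [this]

/-- The Gram determinant form: sesquilinear (conjugate-linear in `x`), with
`gramInner (v₁ ∧ ⋯ ∧ vₙ) (w₁ ∧ ⋯ ∧ wₙ) = det ⟪v i, w j⟫`. -/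
def gramInner (x y : ⋀[ℂ]^n H) : ℂ :=
  conj (exteriorPower.alternatingMapLinearEquiv (gramRight y) x)

theorem gramInner_ιMulti_left (w : Fin n → H) (y : ⋀[ℂ]^n H) :
    gramInner (exteriorPower.ιMulti ℂ n w) y = gramLeft w y := by
  simp [gramInner, gramRight]

theorem gramInner_ιMulti_ιMulti (v w : Fin n → H) :
    gramInner (exteriorPower.ιMulti ℂ n v) (exteriorPower.ιMulti ℂ n w) =
      Matrix.det (Matrix.of fun i j => ⟪v i, w j⟫_ℂ) := by
  rw [gramInner_ιMulti_left, gramLeft_ιMulti]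

theorem gramInner_add_left (x y z : ⋀[ℂ]^n H) :
    gramInner (x + y) z = gramInner x z + gramInner y z := by
  simp [gramInner]

theorem gramInner_smul_left (x y : ⋀[ℂ]^n H) (c : ℂ) :
    gramInner (c • x) y = conj c * gramInner x y := by
  simp [gramInner]

theorem ιMulti_induction {P : ⋀[ℂ]^n H → Prop} (x : ⋀[ℂ]^n H)
    (h : ∀ v, P (exteriorPower.ιMulti ℂ n v)) (h0 : P 0) (ha : ∀ x y, P x → P y → P (x + y))
    (hs : ∀ (c : ℂ) x, P x → P (c • x)) : P x := by
  have hx : x ∈ Submodule.span ℂ (Set.range (exteriorPower.ιMulti ℂ n (M := H))) := by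
    rw [exteriorPower.ιMulti_span]; trivial
  induction hx using Submodule.span_induction with
  | mem x hx => obtain ⟨v, rfl⟩ := hx; exact h v
  | zero => exact h0
  | add x y _ _ hx hy => exact ha x y hx hy
  | smul c x _ hx => exact hs c x hx

theorem gramInner_add_right (x y z : ⋀[ℂ]^n H) :
    gramInner x (y + z) = gramInner x y + gramInner x z := by
  induction x using ιMulti_induction with
  | h v => simp [gramInner_ιMulti_left]
  | h0 => simp [gramInner]
  | ha x x' hx hx' => simp only [gramInner_add_left, hx, hx']; ring
  | hs c x hx => simp only [gramInner_smul_left, hx]; ring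

theorem gramInner_smul_right (x y : ⋀[ℂ]^n H) (c : ℂ) :
    gramInner x (c • y) = c * gramInner x y := by
  induction x using ιMulti_induction with
  | h v => simp [gramInner_ιMulti_left]
  | h0 => simp [gramInner]
  | ha x x' hx hx' => simp only [gramInner_add_left, hx, hx']; ring
  | hs c x hx => simp only [gramInner_smul_left, hx]; ring

theorem gramInner_zero_left (y : ⋀[ℂ]^n H) : gramInner 0 y = 0 := by
  simp [gramInner]

theorem gramInner_zero_right (x : ⋀[ℂ]^n H) : gramInner x 0 = 0 := by
  simpa using gramInner_smul_right x 0 0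

theorem gramInner_conj_symm (x y : ⋀[ℂ]^n H) : conj (gramInner y x) = gramInner x y := by
  induction x using ιMulti_induction with
  | h v =>
    induction y using ιMulti_induction with
    | h w => simp only [gramInner_ιMulti_left, gramLeft_conj]
    | h0 => rw [gramInner_zero_left, gramInner_zero_right, map_zero]
    | ha y y' hy hy' => simp only [gramInner_add_left, gramInner_add_right, map_add, hy, hy']
    | hs c y hy => simp [gramInner_smul_left, gramInner_smul_right, hy]
  | h0 => rw [gramInner_zero_left, gramInner_zero_right, map_zero]
  | ha x x' hx hx' => simp only [gramInner_add_left, gramInner_add_right, map_add, hx, hx']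
  | hs c x hx => simp [gramInner_smul_left, gramInner_smul_right, hx]

/-- Each element of the exterior power comes from a finite-dimensional subspace. -/
theorem exists_finiteDimensional (x : ⋀[ℂ]^n H) :
    ∃ F : Submodule ℂ H, FiniteDimensional ℂ F ∧
      x ∈ LinearMap.range (exteriorPower.map n F.subtype) := by
  have mono : ∀ F G : Submodule ℂ H, F ≤ G → LinearMap.range (exteriorPower.map n F.subtype) ≤
      LinearMap.range (exteriorPower.map n G.subtype) := by
    intro F G h
    rw [← Submodule.subtype_comp_inclusion F G h, exteriorPower.map_comp]
    exact LinearMap.range_comp_le_range _ _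
  induction x using ιMulti_induction with
  | h v =>
    refine ⟨Submodule.span ℂ (Set.range v), FiniteDimensional.span_of_finite ℂ (Set.finite_range v),
      exteriorPower.ιMulti ℂ n (fun i => ⟨v i, Submodule.subset_span ⟨i, rfl⟩⟩), ?_⟩
    rw [exteriorPower.map_apply_ιMulti]
    rfl
  | h0 => exact ⟨⊥, inferInstance, Submodule.zero_mem _⟩
  | ha x y hx hy =>
    obtain ⟨F, hF, hx⟩ := hx
    obtain ⟨G, hG, hy⟩ := hy
    exact ⟨F ⊔ G, inferInstance, Submodule.add_mem _ (mono _ _ le_sup_left hx)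
      (mono _ _ le_sup_right hy)⟩
  | hs c x hx =>
    obtain ⟨F, hF, hx⟩ := hx
    exact ⟨F, hF, Submodule.smul_mem _ c hx⟩

theorem gramInner_map_subtype (F : Submodule ℂ H) (x y : ⋀[ℂ]^n F) :
    gramInner (exteriorPower.map n F.subtype x) (exteriorPower.map n F.subtype y) =
      gramInner x y := by
  induction x using ιMulti_induction with
  | h v =>
    induction y using ιMulti_induction with
    | h w =>
      rw [exteriorPower.map_apply_ιMulti, exteriorPower.map_apply_ιMulti,
        gramInner_ιMulti_ιMulti, gramInner_ιMulti_ιMulti]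
      rfl
    | h0 => rw [map_zero, gramInner_zero_right, gramInner_zero_right]
    | ha y y' hy hy' => simp only [map_add, gramInner_add_right, hy, hy']
    | hs c y hy => simp only [map_smul, gramInner_smul_right, hy]
  | h0 => rw [map_zero, gramInner_zero_left, gramInner_zero_left]
  | ha x x' hx hx' => simp only [map_add, gramInner_add_left, hx, hx']
  | hs c x hx => simp only [map_smul, gramInner_smul_left, hx]

theorem gramInner_ιMulti_family {ι : Type*} [LinearOrder ι] {v : ι → H} (hv : Orthonormal ℂ v)
    (s t : Set.powersetCard ι n) :
    gramInner (exteriorPower.ιMulti_family ℂ n v s) (exteriorPower.ιMulti_family ℂ n v t) =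
      if s = t then 1 else 0 := by
  simp only [exteriorPower.ιMulti_family, gramInner_ιMulti_ιMulti]
  split_ifs with h
  · subst h
    have hc := hv.comp _ (Set.powersetCard.ofFinEmbEquiv.symm s).injective
    rw [← Matrix.det_one (n := Fin n)]
    congr 1
    ext i j
    simpa [Matrix.one_apply] using (orthonormal_iff_ite.mp hc) i j
  · obtain ⟨x, hxt, hxs⟩ := (Set.powersetCard.exists_mem_notMem_iff_ne s t).mp h
    simp only [Set.mem_range, not_exists,
      ← Set.powersetCard.mem_range_ofFinEmbEquiv_symm_iff_mem] at hxs hxt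
    obtain ⟨i, rfl⟩ := hxt
    exact Matrix.det_eq_zero_of_row_eq_zero i
      (fun j => hv.inner_eq_zero (fun h => hxs j h.symm))

theorem gramInner_self_of_finiteDimensional {F : Type*} [NormedAddCommGroup F]
    [InnerProductSpace ℂ F] [FiniteDimensional ℂ F] (x : ⋀[ℂ]^n F) :
    ∃ (b : Module.Basis (Set.powersetCard (Fin (Module.finrank ℂ F)) n) ℂ (⋀[ℂ]^n F)),
      gramInner x x = ((∑ s, ‖b.repr x s‖ ^ 2 : ℝ) : ℂ) := by
  set e := stdOrthonormalBasis ℂ F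
  have hsum : ∀ (y : ⋀[ℂ]^n F) (S : Finset (Set.powersetCard (Fin (Module.finrank ℂ F)) n))
      (f : Set.powersetCard (Fin (Module.finrank ℂ F)) n → ⋀[ℂ]^n F),
      gramInner y (∑ s ∈ S, f s) = ∑ s ∈ S, gramInner y (f s) := by
    intro y S f
    exact map_sum (AddMonoidHom.mk' (gramInner y) (gramInner_add_right y)) f S
  have hsum' : ∀ (y : ⋀[ℂ]^n F) (S : Finset (Set.powersetCard (Fin (Module.finrank ℂ F)) n))
      (f : Set.powersetCard (Fin (Module.finrank ℂ F)) n → ⋀[ℂ]^n F),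
      gramInner (∑ s ∈ S, f s) y = ∑ s ∈ S, gramInner (f s) y := by
    intro y S f
    exact map_sum (AddMonoidHom.mk' (fun x => gramInner x y)
      (fun a b => gramInner_add_left a b y)) f S
  refine ⟨e.toBasis.exteriorPower n, ?_⟩
  conv_lhs => rw [← (e.toBasis.exteriorPower n).sum_repr x]
  simp only [hsum, hsum', gramInner_smul_left, gramInner_smul_right, exteriorPower.coe_basis,
    OrthonormalBasis.coe_toBasis, gramInner_ιMulti_family e.orthonormal]
  push_cast
  refine Finset.sum_congr rfl fun s _ => ?_
  simp [← Complex.mul_conj']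

/-- The inner product on the `n`-th exterior power of a complex inner product space, given by
Gram determinants. -/
instance exteriorPowerCore : InnerProductSpace.Core ℂ (⋀[ℂ]^n H) where
  inner := gramInner
  conj_inner_symm x y := gramInner_conj_symm x y
  add_left := gramInner_add_left
  smul_left := gramInner_smul_left
  re_inner_nonneg x := by
    obtain ⟨F, hF, y, rfl⟩ := exists_finiteDimensional x
    obtain ⟨b, hb⟩ := gramInner_self_of_finiteDimensional y
    rw [gramInner_map_subtype, hb]
    simp only [RCLike.re_to_complex, Complex.ofReal_re]
    positivity
  definite x hx := by
    obtain ⟨F, hF, y, rfl⟩ := exists_finiteDimensional x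
    obtain ⟨b, hb⟩ := gramInner_self_of_finiteDimensional y
    replace hx : gramInner _ _ = 0 := hx
    rw [gramInner_map_subtype, hb, Complex.ofReal_eq_zero,
      Finset.sum_eq_zero_iff_of_nonneg (fun _ _ => sq_nonneg _)] at hx
    have : y = 0 := b.ext_elem (by simpa using hx)
    rw [this, map_zero]

instance exteriorPowerNormed : NormedAddCommGroup (⋀[ℂ]^n H) :=
  InnerProductSpace.Core.toNormedAddCommGroup (𝕜 := ℂ)

instance exteriorPowerInner : InnerProductSpace ℂ (⋀[ℂ]^n H) :=
  InnerProductSpace.ofCore _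

theorem inner_ιMulti_ιMulti (v w : Fin n → H) :
    ⟪exteriorPower.ιMulti ℂ n v, exteriorPower.ιMulti ℂ n w⟫_ℂ =
      Matrix.det (Matrix.of fun i j => ⟪v i, w j⟫_ℂ) :=
  gramInner_ιMulti_ιMulti v w

end ExteriorPower

section Fock

variable (H : Type*) [NormedAddCommGroup H] [InnerProductSpace ℂ H]

/-- The fermionic Fock space of `H`: the Hilbert space direct sum over `n` of the completed
exterior powers of `H`. -/
abbrev Fock : Type _ := lp (fun n : ℕ => UniformSpace.Completion (⋀[ℂ]^n H)) 2

variable {H}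

/-- The vector `v₁ ∧ ⋯ ∧ vₙ` of Fock space (the vacuum if `n = 0`). -/
def wedge {n : ℕ} (v : Fin n → H) : Fock H :=
  lp.single 2 n ((exteriorPower.ιMulti ℂ n v : ⋀[ℂ]^n H) : UniformSpace.Completion (⋀[ℂ]^n H))

theorem inner_wedge_wedge {n : ℕ} (v w : Fin n → H) :
    ⟪wedge v, wedge w⟫_ℂ = Matrix.det (Matrix.of fun i j => ⟪v i, w j⟫_ℂ) := by
  rw [wedge, wedge, lp.inner_single_left, lp.single_apply_self, UniformSpace.Completion.inner_coe,
    inner_ιMulti_ιMulti]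

theorem inner_wedge_wedge_of_ne {m n : ℕ} (h : m ≠ n) (v : Fin m → H) (w : Fin n → H) :
    ⟪wedge v, wedge w⟫_ℂ = 0 := by
  rw [wedge, wedge, lp.inner_single_left, lp.single_apply_ne _ _ _ h, inner_zero_right]

theorem dense_span_wedge :
    Dense (Submodule.span ℂ {x : Fock H | ∃ (n : ℕ) (v : Fin n → H), x = wedge v} :
      Set (Fock H)) := by
  set W := Submodule.span ℂ {x : Fock H | ∃ (n : ℕ) (v : Fin n → H), x = wedge v}
  have h1 : ∀ (n : ℕ) (y : UniformSpace.Completion (⋀[ℂ]^n H)),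
      (lp.single 2 n y : Fock H) ∈ W.topologicalClosure := by
    intro n y
    induction y using UniformSpace.Completion.induction_on with
    | hp =>
      refine W.isClosed_topologicalClosure.preimage ?_
      exact (lp.isometry_single (E := fun n : ℕ => UniformSpace.Completion (⋀[ℂ]^n H))
        (p := 2) n).continuous
    | ih x =>
      refine W.le_topologicalClosure ?_
      induction x using ιMulti_induction with
      | h v => exact Submodule.subset_span ⟨n, v, rfl⟩
      | h0 =>
        have : (lp.single 2 n ((0 : ⋀[ℂ]^n H) : UniformSpace.Completion (⋀[ℂ]^n H)) : Fock H)
            = 0 := by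
          rw [UniformSpace.Completion.coe_zero, lp.single_zero]
        rw [this]
        exact W.zero_mem
      | ha x y hx hy =>
        rw [UniformSpace.Completion.coe_add, lp.single_add]
        exact W.add_mem hx hy
      | hs c x hx =>
        rw [UniformSpace.Completion.coe_smul, lp.single_smul]
        exact W.smul_mem c hx
  rw [Submodule.dense_iff_topologicalClosure_eq_top, eq_top_iff]
  intro x _
  exact W.isClosed_topologicalClosure.mem_of_tendsto (lp.hasSum_single (by simp) x)
    (Filter.Eventually.of_forall fun s => Submodule.sum_mem _ fun i _ => h1 i _)

/-- `R` is the second quantization of `T`: the bounded operator on Fock space with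
`R (v₁ ∧ ⋯ ∧ vₙ) = T v₁ ∧ ⋯ ∧ T vₙ` for all `n` and all `v₁, …, vₙ`. -/
def IsSecondQuantization (T : H →L[ℂ] H) (R : Fock H →L[ℂ] Fock H) : Prop :=
  ∀ (n : ℕ) (v : Fin n → H), R (wedge v) = wedge (fun i => T (v i))

theorem IsSecondQuantization.unique {T : H →L[ℂ] H} {R R' : Fock H →L[ℂ] Fock H}
    (h : IsSecondQuantization T R) (h' : IsSecondQuantization T R') : R = R' := by
  refine ContinuousLinearMap.ext_on dense_span_wedge ?_
  rintro _ ⟨n, v, rfl⟩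
  rw [h, h']

open Classical in
/-- The second quantization `⋀T` of `T` (zero if there is no bounded such operator). -/
def secondQuantization (T : H →L[ℂ] H) : Fock H →L[ℂ] Fock H :=
  if h : ∃ R, IsSecondQuantization T R then h.choose else 0

theorem secondQuantization_eq {T : H →L[ℂ] H} {R : Fock H →L[ℂ] Fock H}
    (h : IsSecondQuantization T R) : secondQuantization T = R := by
  have h' : ∃ R, IsSecondQuantization T R := ⟨R, h⟩
  rw [secondQuantization, dif_pos h']
  exact h'.choose_spec.unique h

end Fock

section Trace

theorem summable_of_tsum_enorm_sq {ι E : Type*} [NormedAddCommGroup E] {f : ι → E} (h : ∑' i, ‖f i‖ₑ ^ 2 ≠ ∞) :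
    Summable fun i => ‖f i‖ ^ 2 := by
  have := ENNReal.summable_toReal h
  simpa using this

variable (K : Type*) [NormedAddCommGroup K] [InnerProductSpace ℂ K] [CompleteSpace K]

/-- Index set of a chosen Hilbert basis of `K`. -/
def basisIndex : Set K := (exists_hilbertBasis ℂ K).choose

/-- A chosen Hilbert basis of `K`. -/
def stdHilbertBasis : HilbertBasis (basisIndex K) ℂ K :=
  (exists_hilbertBasis ℂ K).choose_spec.choose

variable {K}

/-- The trace, with values in `[0, ∞]`, of a positive operator. -/
def posTrace (A : K →L[ℂ] K) : ℝ≥0∞ :=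
  ∑' i, ENNReal.ofReal (⟪stdHilbertBasis K i, A (stdHilbertBasis K i)⟫_ℂ).re

/-- `A` is of trace class if `Tr |A| < ∞`. -/
def IsTraceClass (A : K →L[ℂ] K) : Prop := posTrace (CFC.abs A) < ∞

/-- The trace of a trace-class operator. -/
def trace (A : K →L[ℂ] K) : ℂ :=
  ∑' i, ⟪stdHilbertBasis K i, A (stdHilbertBasis K i)⟫_ℂ

theorem hasSum_norm_inner_sq {ι : Type*} (c : HilbertBasis ι ℂ K) (x : K) :
    HasSum (fun i => ‖⟪c i, x⟫_ℂ‖ ^ 2) (‖x‖ ^ 2) := by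
  have h := (c.hasSum_inner_mul_inner x x).mapL Complex.reCLM
  have e : Complex.reCLM ⟪x, x⟫_ℂ = ‖x‖ ^ 2 := by
    rw [inner_self_eq_norm_sq_to_K]
    simp [← Complex.ofReal_pow]
  rw [e] at h
  have e' : (fun i => ‖⟪c i, x⟫_ℂ‖ ^ 2) = fun i => Complex.reCLM (⟪x, c i⟫_ℂ * ⟪c i, x⟫_ℂ) := by
    funext i
    rw [← inner_conj_symm x, Complex.conj_mul', Complex.reCLM_apply, ← Complex.ofReal_pow,
      Complex.ofReal_re]
  rw [e']
  exact h

theorem enorm_sq_eq_tsum {ι : Type*} (c : HilbertBasis ι ℂ K) (x : K) :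
    ‖x‖ₑ ^ 2 = ∑' i, ‖⟪c i, x⟫_ℂ‖ₑ ^ 2 := by
  have h := hasSum_norm_inner_sq c x
  have h2 := ENNReal.ofReal_tsum_of_nonneg (fun i => sq_nonneg ‖⟪c i, x⟫_ℂ‖) h.summable
  rw [h.tsum_eq] at h2
  simpa [ENNReal.ofReal_pow, ofReal_norm] using h2

theorem tsum_enorm_sq_adjoint {ι κ : Type*} (b : HilbertBasis ι ℂ K) (c : HilbertBasis κ ℂ K)
    (S : K →L[ℂ] K) : ∑' i, ‖S (b i)‖ₑ ^ 2 = ∑' j, ‖S.adjoint (c j)‖ₑ ^ 2 := by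
  simp_rw [enorm_sq_eq_tsum c (S _), enorm_sq_eq_tsum b (S.adjoint _)]
  rw [ENNReal.tsum_comm]
  refine tsum_congr fun j => tsum_congr fun i => ?_
  rw [← ContinuousLinearMap.adjoint_inner_left, ← ofReal_norm, ← ofReal_norm, norm_inner_symm]

theorem inner_eq_sqrt {A : K →L[ℂ] K} (hA : 0 ≤ A) (x y : K) :
    ⟪x, A y⟫_ℂ = ⟪CFC.sqrt A x, CFC.sqrt A y⟫_ℂ := by
  have h : (CFC.sqrt A).adjoint = CFC.sqrt A :=
    (IsSelfAdjoint.of_nonneg (CFC.sqrt_nonneg A)).star_eq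
  conv_lhs => rw [← CFC.sqrt_mul_sqrt_self A hA]
  rw [mul_apply_eq_comp, ← ContinuousLinearMap.adjoint_inner_left, h]

theorem ofReal_inner_eq {A : K →L[ℂ] K} (hA : 0 ≤ A) (x : K) :
    ENNReal.ofReal (⟪x, A x⟫_ℂ).re = ‖CFC.sqrt A x‖ₑ ^ 2 := by
  rw [inner_eq_sqrt hA, inner_self_eq_norm_sq_to_K, ← ofReal_norm,
    ← ENNReal.ofReal_pow (norm_nonneg _)]
  simp [← Complex.ofReal_pow]

theorem posTrace_eq_sqrt {A : K →L[ℂ] K} (hA : 0 ≤ A) :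
    posTrace A = ∑' i, ‖CFC.sqrt A (stdHilbertBasis K i)‖ₑ ^ 2 :=
  tsum_congr fun _ => ofReal_inner_eq hA _

/-- The trace of a positive operator can be computed in any Hilbert basis. -/
theorem posTrace_eq {A : K →L[ℂ] K} (hA : 0 ≤ A) {ι : Type*} (c : HilbertBasis ι ℂ K) :
    posTrace A = ∑' i, ENNReal.ofReal (⟪c i, A (c i)⟫_ℂ).re := by
  have h : (CFC.sqrt A).adjoint = CFC.sqrt A :=
    (IsSelfAdjoint.of_nonneg (CFC.sqrt_nonneg A)).star_eq
  rw [posTrace_eq_sqrt hA, tsum_enorm_sq_adjoint _ c, h]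
  exact tsum_congr fun _ => (ofReal_inner_eq hA _).symm

variable (K) in
/-- A density matrix on `K`: a positive operator of trace one. -/
structure DensityMatrix where
  op : K →L[ℂ] K
  nonneg : 0 ≤ op
  posTrace_op : posTrace op = 1

theorem DensityMatrix.summable_inner (ρ : DensityMatrix K) (a : K →L[ℂ] K) :
    Summable fun i => ⟪stdHilbertBasis K i, (ρ.op * a) (stdHilbertBasis K i)⟫_ℂ := by
  set b := stdHilbertBasis K
  set S := CFC.sqrt ρ.op
  have hS : S.adjoint = S := (IsSelfAdjoint.of_nonneg (CFC.sqrt_nonneg ρ.op)).star_eq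
  have h0 : ∑' i, ‖S (b i)‖ₑ ^ 2 = 1 := (posTrace_eq_sqrt ρ.nonneg).symm.trans ρ.posTrace_op
  have h1 : Summable fun i => ‖S (b i)‖ ^ 2 :=
    summable_of_tsum_enorm_sq (by rw [h0]; exact ENNReal.one_ne_top)
  have h2 : Summable fun i => ‖(S * a) (b i)‖ ^ 2 := by
    refine summable_of_tsum_enorm_sq ?_
    rw [tsum_enorm_sq_adjoint b b]
    refine ne_top_of_le_ne_top (b := ‖a.adjoint‖ₑ ^ 2 * 1) (by simp) ?_
    rw [← h0, ← ENNReal.tsum_mul_left]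
    refine ENNReal.tsum_le_tsum fun i => ?_
    rw [← mul_pow]
    gcongr
    have : (S * a).adjoint (b i) = a.adjoint (S (b i)) := by
      rw [ContinuousLinearMap.mul_def, ContinuousLinearMap.adjoint_comp, hS]; rfl
    rw [this]
    exact a.adjoint.le_opENorm _
  refine Summable.of_norm_bounded (h1.add h2) fun i => ?_
  rw [mul_apply_eq_comp, inner_eq_sqrt ρ.nonneg]
  refine (norm_inner_le_norm _ _).trans ?_
  change ‖S (b i)‖ * ‖(S * a) (b i)‖ ≤ _
  nlinarith [sq_nonneg (‖S (b i)‖ - ‖(S * a) (b i)‖), sq_nonneg (‖S (b i)‖ + ‖(S * a) (b i)‖)]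

/-- The state `a ↦ Tr (ρ a)` on the algebra of bounded operators induced by a density matrix. -/
def DensityMatrix.state (ρ : DensityMatrix K) : (K →L[ℂ] K) →ₗ[ℂ] ℂ where
  toFun a := trace (ρ.op * a)
  map_add' a a' := by
    simp only [trace, mul_add, add_apply, inner_add_right]
    exact (ρ.summable_inner a).tsum_add (ρ.summable_inner a')
  map_smul' c a := by
    simp only [trace, mul_smul_comm, smul_apply, inner_smul_right,
      RingHom.id_apply, smul_eq_mul]
    exact tsum_mul_left

theorem DensityMatrix.state_rankOne (ρ : DensityMatrix K) (x y : K) :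
    ρ.state (InnerProductSpace.rankOne ℂ x y) = ⟪y, ρ.op x⟫_ℂ := by
  change trace _ = _
  rw [← (stdHilbertBasis K).tsum_inner_mul_inner y (ρ.op x)]
  refine tsum_congr fun i => ?_
  simp

theorem DensityMatrix.state_injective :
    Function.Injective (DensityMatrix.state : DensityMatrix K → _) := by
  rintro ρ ρ' h
  have : ρ.op = ρ'.op := by
    refine ContinuousLinearMap.ext fun x => ext_inner_left ℂ fun y => ?_
    rw [← ρ.state_rankOne, ← ρ'.state_rankOne, h]
  cases ρ; cases ρ'; congr

theorem DensityMatrix.op_le_one (ρ : DensityMatrix K) : ρ.op ≤ 1 := by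
  set b := stdHilbertBasis K
  set S := CFC.sqrt ρ.op
  have hS : S.adjoint = S := (IsSelfAdjoint.of_nonneg (CFC.sqrt_nonneg ρ.op)).star_eq
  have h0 : ∑' i, ‖S (b i)‖ₑ ^ 2 = 1 := (posTrace_eq_sqrt ρ.nonneg).symm.trans ρ.posTrace_op
  rw [ContinuousLinearMap.le_def, ContinuousLinearMap.isPositive_def']
  refine ⟨(IsSelfAdjoint.one _).sub (IsSelfAdjoint.of_nonneg ρ.nonneg), fun x => ?_⟩
  have h1 : ‖S x‖ₑ ^ 2 ≤ ‖x‖ₑ ^ 2 := by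
    rw [enorm_sq_eq_tsum b (S x), ← one_mul (‖x‖ₑ ^ 2), ← h0, ← ENNReal.tsum_mul_right]
    refine ENNReal.tsum_le_tsum fun i => ?_
    rw [← ContinuousLinearMap.adjoint_inner_left, hS, ← mul_pow]
    gcongr
    rw [← ofReal_norm, ← ofReal_norm, ← ofReal_norm, ← ENNReal.ofReal_mul (norm_nonneg _)]
    exact ENNReal.ofReal_le_ofReal (norm_inner_le_norm _ _)
  have h2 : ‖S x‖ ≤ ‖x‖ := by
    have := (ENNReal.pow_le_pow_left_iff two_ne_zero).mp h1
    simpa [enorm_le_iff_norm_le] using this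
  rw [ContinuousLinearMap.reApplyInnerSelf_apply, sub_apply, inner_sub_left,
    ← inner_conj_symm (ρ.op x), inner_eq_sqrt ρ.nonneg]
  simp only [one_apply_eq_self, inner_self_eq_norm_sq_to_K]
  simp [← Complex.ofReal_pow]
  gcongr

/-- The operator `-ρ log ρ`, with the convention `0 log 0 = 0`. -/
def DensityMatrix.negMulLog (ρ : DensityMatrix K) : K →L[ℂ] K := cfc Real.negMulLog ρ.op

theorem DensityMatrix.negMulLog_nonneg (ρ : DensityMatrix K) : 0 ≤ ρ.negMulLog := by
  have hsa : IsSelfAdjoint ρ.op := IsSelfAdjoint.of_nonneg ρ.nonneg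
  refine cfc_nonneg fun x hx => Real.negMulLog_nonneg (spectrum_nonneg_of_nonneg ρ.nonneg hx) ?_
  exact (cfc_le_one_iff (R := ℝ) id ρ.op).mp (by rw [cfc_id ℝ ρ.op]; exact ρ.op_le_one) x hx

open Classical in
/-- The von Neumann entropy `S(φ) = - Tr (ρ log ρ) ∈ [0, ∞]` of the functional `φ` induced by
the (unique) density matrix `ρ`; zero if there is no such `ρ`. -/
def vonNeumannEntropy (φ : (K →L[ℂ] K) →ₗ[ℂ] ℂ) : ℝ≥0∞ :=
  if h : ∃ ρ : DensityMatrix K, ρ.state = φ then posTrace h.choose.negMulLog else 0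

theorem vonNeumannEntropy_state (ρ : DensityMatrix K) :
    vonNeumannEntropy ρ.state = posTrace ρ.negMulLog := by
  have h : ∃ ρ' : DensityMatrix K, ρ'.state = ρ.state := ⟨ρ, rfl⟩
  rw [vonNeumannEntropy, dif_pos h, DensityMatrix.state_injective h.choose_spec]

/-- The function `𝓔(x) = log (1 + x) - x log x / (1 + x)`, with `𝓔(0) = 0`. -/
def entropyFn (x : ℝ) : ℝ := Real.log (1 + x) - x * Real.log x / (1 + x)

theorem entropyFn_continuousOn : ContinuousOn entropyFn (Set.Ici 0) := by
  intro x hx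
  have hx' : 1 + x ≠ 0 := by have : 0 ≤ x := hx; positivity
  have h1 : ContinuousAt (fun x : ℝ => Real.log (1 + x)) x :=
    (continuousAt_const.add continuousAt_id).log hx'
  have h2 : ContinuousAt (fun x : ℝ => x * Real.log x / (1 + x)) x :=
    Real.continuous_mul_log.continuousAt.div (continuousAt_const.add continuousAt_id) hx'
  exact (h1.sub h2).continuousWithinAt

theorem entropyFn_nonneg {x : ℝ} (hx : 0 ≤ x) : 0 ≤ entropyFn x := by
  rcases hx.eq_or_lt with rfl | h
  · simp [entropyFn]
  rw [entropyFn, sub_nonneg, div_le_iff₀ (by positivity)]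
  have h1 : Real.log x ≤ Real.log (1 + x) := Real.log_le_log h (by linarith)
  have h2 : 0 ≤ Real.log (1 + x) := Real.log_nonneg (by linarith)
  nlinarith

theorem cfc_entropyFn_nonneg {T : K →L[ℂ] K} (hT : 0 ≤ T) : 0 ≤ cfc entropyFn T :=
  cfc_nonneg fun _ hx => entropyFn_nonneg (spectrum_nonneg_of_nonneg hT hx)

end Trace
end FermionicFock
end

/-! Everything is diagonalised, and the formula becomes the additivity of Shannon entropy over
independent events.

Since `T` is positive and of trace class, its square root is Hilbert–Schmidt, so `T` is compact. The
spectral theorem then gives a Hilbert basis `b i` of eigenvectors with eigenvalues `l i ≥ 0`, and `∑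
l i < ∞`. The wedges of the `b i` along finite sets `s` form a Hilbert basis of Fock space
(`wedgeBasis`), and `⋀T` is the operator diagonal in it with eigenvalues `∏ i ∈ s, l i`
(`isSecondQuantization_of_diagonal`). Its trace is the expansion of `Z = ∏ (1 + l i)`, which is
finite and positive.

So `ρ` has eigenvalues `p s = Z⁻¹ * ∏ i ∈ s, l i`. This is the law of a random finite set containing
each `i` independently with probability `l i / (1 + l i)`, and `𝓔 (l i)` is the entropy of that
single choice. Additivity is proved in `tsum_negMulLog_prod`: where `p s ≠ 0`, `- log p s` is a sum
over `i` of nonnegative terms, so the two sums may be exchanged in `[0, ∞]` even when the entropy is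
infinite, and the inner sum sees only the probability of `i ∈ s`. Both traces are read off in
eigenbases through `posTrace_of_diagonal` and `cfc_apply_of_apply_eq`. -/

noncomputable section

namespace FermionicFock

/-! ### Hilbert bases, eigenvalues and rank-one operators -/

section InnerProduct

variable {K : Type*} [NormedAddCommGroup K] [InnerProductSpace ℂ K] {ι : Type*} {A : K →L[ℂ] K}

theorem ext_hilbertBasis {A B : K →L[ℂ] K} (c : HilbertBasis ι ℂ K)
    (h : ∀ i, A (c i) = B (c i)) : A = B := by
  refine ContinuousLinearMap.ext_on (s := Set.range c) ?_ ?_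
  · rw [Submodule.dense_iff_topologicalClosure_eq_top, c.dense_span]
  · rintro _ ⟨i, rfl⟩
    exact h i

theorem eq_of_inner_hilbertBasis {x y : K} (c : HilbertBasis ι ℂ K)
    (h : ∀ i, ⟪c i, x⟫_ℂ = ⟪c i, y⟫_ℂ) : x = y := by
  refine c.repr.injective (lp.ext (funext fun i => ?_))
  rw [c.repr_apply_apply, c.repr_apply_apply, h]

theorem mem_spectrum_of_apply_eq {v : K} (hv : v ≠ 0) {r : ℝ} (h : A v = (r : ℂ) • v) :
    r ∈ spectrum ℝ A := by
  intro hu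
  obtain ⟨u, hu⟩ := hu
  refine hv ?_
  have h1 : (u : K →L[ℂ] K) v = 0 := by
    rw [hu]
    simp [h, Algebra.algebraMap_eq_smul_one]
  have h2 : ((u⁻¹ : (K →L[ℂ] K)ˣ) : K →L[ℂ] K) ((u : K →L[ℂ] K) v) = v := by
    rw [← mul_apply_eq_comp, Units.inv_mul]
    rfl
  rw [← h2, h1, map_zero]

theorem isCompactOperator_rankOne (x y : K) :
    IsCompactOperator (InnerProductSpace.rankOne ℂ x y : K →L[ℂ] K) := by
  have h := (isCompactOperator_of_locallyCompactSpace_dom (innerSL ℂ y)).clm_comp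
    (ContinuousLinearMap.toSpanSingleton ℂ x)
  exact h

end InnerProduct

/-! ### Operators diagonal in a Hilbert basis, their traces and functional calculus -/

section Diagonal

variable {K : Type*} [NormedAddCommGroup K] [InnerProductSpace ℂ K] [CompleteSpace K]
  {ι : Type*} {c : HilbertBasis ι ℂ K} {μ : ι → ℝ} {A : K →L[ℂ] K}

/-- The eigenvalues are real and the basis is orthonormal, so the adjoint of `A` has the same
eigenvectors and eigenvalues; move `A` to the left side. -/
theorem inner_apply_of_diagonal (h : ∀ i, A (c i) = (μ i : ℂ) • c i) (i : ι) (x : K) :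
    ⟪c i, A x⟫_ℂ = μ i * ⟪c i, x⟫_ℂ := by
  have hA : A.adjoint (c i) = (μ i : ℂ) • c i := by
    classical
    refine eq_of_inner_hilbertBasis c fun j => ?_
    rw [ContinuousLinearMap.adjoint_inner_right, h, inner_smul_left, inner_smul_right,
      orthonormal_iff_ite.mp c.orthonormal]
    split_ifs with hij
    · subst hij; simp
    · simp
  rw [← ContinuousLinearMap.adjoint_inner_left, hA, inner_smul_left, Complex.conj_ofReal]

theorem nonneg_of_diagonal (h : ∀ i, A (c i) = (μ i : ℂ) • c i) (hμ : ∀ i, 0 ≤ μ i) : 0 ≤ A := by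
  rw [ContinuousLinearMap.nonneg_iff_isPositive, ContinuousLinearMap.isPositive_def']
  have hs : A.adjoint = A := by
    refine ext_hilbertBasis c fun i => eq_of_inner_hilbertBasis c fun j => ?_
    rw [ContinuousLinearMap.adjoint_inner_right, h, inner_apply_of_diagonal h,
      inner_smul_left, Complex.conj_ofReal]
  refine ⟨hs, fun x => ?_⟩
  have hx := (c.hasSum_inner_mul_inner x (A x)).mapL Complex.reCLM
  rw [ContinuousLinearMap.reApplyInnerSelf_apply, inner_re_symm]
  have := hx.nonneg fun i => by
    rw [inner_apply_of_diagonal h, mul_left_comm, ← inner_conj_symm x, Complex.conj_mul',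
      Complex.reCLM_apply, ← Complex.ofReal_pow, ← Complex.ofReal_mul, Complex.ofReal_re]
    exact mul_nonneg (hμ i) (sq_nonneg _)
  simpa using this

theorem posTrace_of_diagonal (h : ∀ i, A (c i) = (μ i : ℂ) • c i) (hμ : ∀ i, 0 ≤ μ i) :
    posTrace A = ∑' i, ENNReal.ofReal (μ i) := by
  rw [posTrace_eq (nonneg_of_diagonal h hμ) c]
  refine tsum_congr fun i => ?_
  rw [inner_apply_of_diagonal h, inner_self_eq_norm_sq_to_K, c.orthonormal.norm_eq_one]
  simp

theorem isTraceClass_iff_of_nonneg (hA : 0 ≤ A) : IsTraceClass A ↔ posTrace A < ∞ := by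
  rw [IsTraceClass, CFC.abs_of_nonneg A hA]

/-- No finiteness is needed: if the series diverges, both sides take the default value `0`. -/
theorem trace_eq_posTrace (hA : 0 ≤ A) :
    trace A = ((posTrace A).toReal : ℂ) := by
  have hr : ∀ x, ⟪x, A x⟫_ℂ = ((⟪x, A x⟫_ℂ).re : ℂ) ∧ 0 ≤ (⟪x, A x⟫_ℂ).re := by
    intro x
    rw [inner_eq_sqrt hA, inner_self_eq_norm_sq_to_K]
    simp [← Complex.ofReal_pow]
  rw [posTrace, ENNReal.tsum_toReal_eq (fun _ => ENNReal.ofReal_ne_top), trace, Complex.ofReal_tsum]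
  refine tsum_congr fun i => ?_
  rw [ENNReal.toReal_ofReal (hr _).2, ← (hr _).1]

theorem cfc_apply_of_apply_eq (hA : IsSelfAdjoint A) {f : ℝ → ℝ}
    (hf : ContinuousOn f (spectrum ℝ A)) {v : K} {r : ℝ} (h : A v = (r : ℂ) • v) :
    cfc f A v = (f r : ℂ) • v := by
  by_cases hv : v = 0
  · simp [hv]
  have hr := mem_spectrum_of_apply_eq hv h
  rw [cfc_apply f A]
  -- The claim holds for constants and the identity and is stable under sums, products and uniform
  -- limits, so Stone–Weierstrass gives it for every continuous function on the spectrum.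
  have key : ∀ g : C(spectrum ℝ A, ℝ), cfcHom hA g v = (g ⟨r, hr⟩ : ℂ) • v := by
    intro g
    induction g using ContinuousMap.induction_on_of_compact with
    | const s =>
      have : ContinuousMap.const (spectrum ℝ A) s = algebraMap ℝ C(spectrum ℝ A, ℝ) s := rfl
      rw [this, AlgHomClass.commutes]
      simp [Algebra.algebraMap_eq_smul_one]
    | id =>
      have : cfcHom hA (.restrict (spectrum ℝ A) (.id ℝ)) = A := cfcHom_id hA
      rw [this, h]
      rfl
    | star_id =>
      have : cfcHom hA (star (.restrict (spectrum ℝ A) (.id ℝ))) = A := by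
        rw [map_star, cfcHom_id hA, hA.star_eq]
      rw [this, h]
      rfl
    | add f g hf hg => simp [hf, hg, add_smul]
    | mul f g hf hg =>
      rw [map_mul, mul_apply_eq_comp, hg, map_smul, hf, smul_smul, ContinuousMap.mul_apply,
        Complex.ofReal_mul, mul_comm]
    | frequently g hg =>
      have hcl : IsClosed {g : C(spectrum ℝ A, ℝ) | cfcHom hA g v = (g ⟨r, hr⟩ : ℂ) • v} := by
        refine isClosed_eq ?_ ?_
        · exact (ContinuousLinearMap.apply ℂ K v).continuous.comp (cfcHom_continuous hA)
        · exact (Complex.continuous_ofReal.comp (continuous_eval_const _)).smul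
            continuous_const
      exact hcl.closure_subset (mem_closure_iff_frequently.mpr hg)
  exact key _

end Diagonal

/-! ### Trace-class operators are compact; eigenbases of positive compact operators -/

section Spectral

variable {K : Type*} [NormedAddCommGroup K] [InnerProductSpace ℂ K] [CompleteSpace K]

/-- The operator norm is bounded by the Hilbert–Schmidt norm. -/
theorem enorm_apply_sq_le {ι : Type*} (c : HilbertBasis ι ℂ K) (S : K →L[ℂ] K) (x : K) :
    ‖S x‖ₑ ^ 2 ≤ (∑' i, ‖S (c i)‖ₑ ^ 2) * ‖x‖ₑ ^ 2 := by
  rw [enorm_sq_eq_tsum c (S x), tsum_enorm_sq_adjoint c c, ← ENNReal.tsum_mul_right]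
  refine ENNReal.tsum_le_tsum fun i => ?_
  rw [← ContinuousLinearMap.adjoint_inner_left, ← mul_pow]
  gcongr
  rw [← ofReal_norm, ← ofReal_norm, ← ofReal_norm, ← ENNReal.ofReal_mul (norm_nonneg _)]
  exact ENNReal.ofReal_le_ofReal (norm_inner_le_norm _ _)

theorem norm_le_sqrt_toReal {ι : Type*} (c : HilbertBasis ι ℂ K) {S : K →L[ℂ] K}
    (h : ∑' i, ‖S (c i)‖ₑ ^ 2 ≠ ∞) : ‖S‖ ≤ √(∑' i, ‖S (c i)‖ₑ ^ 2).toReal := by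
  refine ContinuousLinearMap.opNorm_le_bound _ (Real.sqrt_nonneg _) fun x => ?_
  have h1 := ENNReal.toReal_mono (ENNReal.mul_ne_top h (by simp)) (enorm_apply_sq_le c S x)
  rw [ENNReal.toReal_mul, ENNReal.toReal_pow, ENNReal.toReal_pow, toReal_enorm, toReal_enorm] at h1
  refine le_of_sq_le_sq ?_ (by positivity)
  rwa [mul_pow, Real.sq_sqrt ENNReal.toReal_nonneg]

/-- Hilbert–Schmidt operators are compact. -/
theorem isCompactOperator_of_tsum_enorm_sq {ι : Type*} (c : HilbertBasis ι ℂ K) {S : K →L[ℂ] K}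
    (h : ∑' i, ‖S (c i)‖ₑ ^ 2 ≠ ∞) : IsCompactOperator S := by
  classical
  -- `F s` agrees with `S` on the basis vectors indexed by `s` and kills the others. It has finite
  -- rank, and the squared Hilbert–Schmidt norm of `F s - S` is a tail of a convergent sum.
  let F : Finset ι → K →L[ℂ] K := fun s => ∑ i ∈ s, InnerProductSpace.rankOne ℂ (S (c i)) (c i)
  have hF : ∀ s, IsCompactOperator (F s) := fun s =>
    (Submodule.sum_mem (compactOperator (RingHom.id ℂ) K K)
      fun i _ => isCompactOperator_rankOne _ _ : _)
  refine isCompactOperator_of_tendsto (l := Filter.atTop) (F := F) ?_ (.of_forall hF)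
  have hFc : ∀ s i, (F s - S) (c i) = if i ∈ s then 0 else - S (c i) := by
    intro s i
    have : F s (c i) = if i ∈ s then S (c i) else 0 := by
      simp [F, orthonormal_iff_ite.mp c.orthonormal]
    rw [sub_apply, this]
    split_ifs <;> simp
  have htail : ∀ s, ∑' i, ‖(F s - S) (c i)‖ₑ ^ 2 = ∑' i : {i // i ∉ s}, ‖S (c i)‖ₑ ^ 2 := by
    intro s
    refine Eq.trans ?_ (tsum_subtype {i | i ∉ s} fun i => ‖S (c i)‖ₑ ^ 2).symm
    refine tsum_congr fun i => ?_
    rw [hFc]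
    by_cases hi : i ∈ s <;> simp [hi, Set.indicator]
  have hlim := ENNReal.tendsto_tsum_compl_atTop_zero h
  simp_rw [← htail] at hlim
  rw [tendsto_iff_norm_sub_tendsto_zero]
  have hlim' := ((ENNReal.tendsto_toReal ENNReal.zero_ne_top).comp hlim).sqrt
  rw [ENNReal.toReal_zero, Real.sqrt_zero] at hlim'
  refine squeeze_zero (fun _ => norm_nonneg _) (fun s => norm_le_sqrt_toReal c ?_) hlim'
  refine ne_top_of_le_ne_top h (ENNReal.tsum_le_tsum fun i => ?_)
  rw [hFc]
  split_ifs <;> simp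

theorem isCompactOperator_of_isTraceClass {A : K →L[ℂ] K} (hA : 0 ≤ A) (h : IsTraceClass A) :
    IsCompactOperator A := by
  rw [isTraceClass_iff_of_nonneg hA, posTrace_eq_sqrt hA] at h
  have := (isCompactOperator_of_tsum_enorm_sq _ h.ne).comp_clm (CFC.sqrt A)
  rwa [← ContinuousLinearMap.coe_comp, ← ContinuousLinearMap.mul_def,
    CFC.sqrt_mul_sqrt_self A hA] at this

/-- Hilbert bases of the pieces combine into an orthonormal family; a vector orthogonal to all of it
projects to zero in each piece, hence is orthogonal to their supremum. -/
theorem exists_hilbertBasis_mem {κ : Type*} {V : κ → Submodule ℂ K} [∀ k, CompleteSpace (V k)]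
    (hV : OrthogonalFamily ℂ (fun k => V k) fun k => (V k).subtypeₗᵢ) (htop : (⨆ k, V k)ᗮ = ⊥) :
    ∃ b : HilbertBasis (Σ k, basisIndex (V k)) ℂ K, ∀ a, b a ∈ V a.1 := by
  let v : (Σ k, basisIndex (V k)) → K := fun a => (stdHilbertBasis (V a.1) a.2 : K)
  have hv : Orthonormal ℂ v :=
    hV.orthonormal_sigma_orthonormal fun μ => (stdHilbertBasis (V μ)).orthonormal
  have hspan : (Submodule.span ℂ (Set.range v))ᗮ = ⊥ := by
    rw [eq_bot_iff, ← htop, ← Submodule.iInf_orthogonal]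
    intro x hx
    rw [Submodule.mem_iInf]
    intro μ y hy
    have h0 : (V μ).orthogonalProjectionOnto x = 0 := by
      refine eq_of_inner_hilbertBasis (stdHilbertBasis (V μ)) fun i => ?_
      rw [inner_zero_right, Submodule.inner_orthogonalProjectionOnto_eq_of_mem_left]
      exact hx _ (Submodule.subset_span ⟨⟨μ, i⟩, rfl⟩)
    have h1 := Submodule.inner_orthogonalProjectionOnto_eq_of_mem_left (K := V μ) ⟨y, hy⟩ x
    rw [h0, inner_zero_right] at h1
    exact h1.symm
  refine ⟨.mkOfOrthogonalEqBot hv hspan, fun a => ?_⟩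
  rw [HilbertBasis.coe_mkOfOrthogonalEqBot]
  exact (stdHilbertBasis (V a.1) a.2).2

theorem exists_hilbertBasis_eigenvectors.{u} {K : Type u} [NormedAddCommGroup K]
    [InnerProductSpace ℂ K] [CompleteSpace K] {A : K →L[ℂ] K} (hA : 0 ≤ A)
    (hc : IsCompactOperator A) :
    ∃ (ι : Type u) (b : HilbertBasis ι ℂ K) (l : ι → ℝ),
      (∀ i, A (b i) = (l i : ℂ) • b i) ∧ ∀ i, 0 ≤ l i := by
  have hpos := (ContinuousLinearMap.nonneg_iff_isPositive A).mp hA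
  have hsym : (A : K →ₗ[ℂ] K).IsSymmetric := hpos.isSymmetric
  have hE : ∀ μ, CompleteSpace (Module.End.eigenspace (A : K →ₗ[ℂ] K) μ) := fun μ => by
    have e : (Module.End.eigenspace (A : K →ₗ[ℂ] K) μ : Set K) = {x | A x = μ • x} := by
      ext x
      exact Module.End.mem_eigenspace_iff
    have hcl := isClosed_eq A.continuous (continuous_const_smul μ)
    rw [← e] at hcl
    exact hcl.completeSpace_coe
  obtain ⟨b, hb⟩ := exists_hilbertBasis_mem hsym.orthogonalFamily_eigenspaces
    (ContinuousLinearMap.orthogonalComplement_iSup_eigenspaces_eq_bot hc hsym)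
  have hAb : ∀ a : Σ μ, basisIndex (Module.End.eigenspace (A : K →ₗ[ℂ] K) μ),
      A (b a) = a.1 • b a := fun a => Module.End.mem_eigenspace_iff.mp (hb a)
  -- Positivity tested on a unit eigenvector makes the eigenvalue nonnegative in the order of `ℂ`,
  -- which includes being real. Scalars that are not eigenvalues contribute no basis vectors.
  have h0 : ∀ a : Σ μ, basisIndex (Module.End.eigenspace (A : K →ₗ[ℂ] K) μ),
      0 ≤ a.1.re ∧ 0 = a.1.im := fun a => by
    have h := hpos.inner_nonneg_right (b a)
    rw [hAb, inner_smul_right, inner_self_eq_norm_sq_to_K, b.orthonormal.norm_eq_one] at h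
    exact Complex.nonneg_iff.mp (by simpa using h)
  refine ⟨_, b, fun a => a.1.re, fun a => ?_, fun a => (h0 a).1⟩
  rw [hAb]
  congr 1
  exact Complex.ext rfl (h0 a).2.symm

end Spectral

/-! ### The Hilbert basis of Fock space -/

section WedgeBasis

variable {H : Type*} [NormedAddCommGroup H] [InnerProductSpace ℂ H] {ι : Type*} [LinearOrder ι]

/-- The squared distance of two wedges expands into four Gram determinants, which are polynomial in
inner products. -/
theorem continuous_wedge (n : ℕ) : Continuous fun v : Fin n → H => wedge v := by
  rw [continuous_iff_continuousAt]
  intro w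
  have hdet : ∀ a b : (Fin n → H) → Fin n → H, Continuous a → Continuous b →
      Continuous fun v => ⟪wedge (a v), wedge (b v)⟫_ℂ := by
    intro a b ha hb
    simp_rw [inner_wedge_wedge]
    refine Continuous.matrix_det (continuous_matrix fun i j => ?_)
    exact ((continuous_apply i).comp ha).inner ((continuous_apply j).comp hb)
  have h : Continuous fun v : Fin n → H => ‖wedge v - wedge w‖ ^ 2 := by
    have e : ∀ v : Fin n → H, ‖wedge v - wedge w‖ ^ 2 =
        Complex.re (⟪wedge v, wedge v⟫_ℂ - ⟪wedge v, wedge w⟫_ℂ - ⟪wedge w, wedge v⟫_ℂ +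
          ⟪wedge w, wedge w⟫_ℂ) := fun v => by
      rw [← inner_self_eq_norm_sq (𝕜 := ℂ), inner_sub_sub_self]
      rfl
    simp_rw [e]
    have h1 := hdet id id continuous_id continuous_id
    have h2 := hdet id (fun _ => w) continuous_id continuous_const
    have h3 := hdet (fun _ => w) id continuous_const continuous_id
    exact Complex.continuous_re.comp (((h1.sub h2).sub h3).add continuous_const)
  rw [ContinuousAt, tendsto_iff_norm_sub_tendsto_zero]
  have := (h.tendsto w).sqrt
  simpa using this

/-- The wedge product of the family `b` along a finite set `s`, in increasing order. -/
def wedgeFinset (b : ι → H) (s : Finset ι) : Fock H :=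
  wedge fun i : Fin s.card => b (s.orderEmbOfFin rfl i)

/-- The degree `n` is free, so that sets whose cardinalities are equal only propositionally can be
compared inside one exterior power. -/
theorem wedgeFinset_eq (b : ι → H) {n : ℕ} (s : Set.powersetCard ι n) :
    wedgeFinset b s.1 = lp.single 2 n ((exteriorPower.ιMulti_family ℂ n b s : ⋀[ℂ]^n H) :
      UniformSpace.Completion (⋀[ℂ]^n H)) := by
  obtain ⟨s, rfl⟩ := s
  rfl

theorem orthonormal_wedgeFinset {b : ι → H} (hb : Orthonormal ℂ b) :
    Orthonormal ℂ (wedgeFinset b) := by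
  rw [orthonormal_iff_ite]
  intro s t
  by_cases h : s.card = t.card
  · have := wedgeFinset_eq b (n := t.card) ⟨s, h⟩
    have h2 := wedgeFinset_eq b (n := t.card) ⟨t, rfl⟩
    simp only at this h2
    rw [this, h2, lp.inner_single_left, lp.single_apply_self, UniformSpace.Completion.inner_coe]
    refine (gramInner_ιMulti_family hb _ _).trans ?_
    simp [Subtype.ext_iff]
  · rw [if_neg (fun e => h (by rw [e]))]
    exact inner_wedge_wedge_of_ne h _ _

theorem wedge_mem_of_mem_span {b : ι → H} {n : ℕ} {v : Fin n → H}
    (hv : ∀ i, v i ∈ Submodule.span ℂ (Set.range b)) :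
    wedge v ∈ Submodule.span ℂ (Set.range (wedgeFinset b)) := by
  have h : exteriorPower.ιMulti ℂ n v ∈
      Submodule.span ℂ (Set.range (exteriorPower.ιMulti_family ℂ n b)) := by
    -- The target is the image of the exterior power of the span of `b`, where the `v i` already
    -- live.
    rw [← exteriorPower.ιMulti_family_span]
    refine ⟨exteriorPower.ιMulti ℂ n fun i => ⟨v i, hv i⟩, ?_⟩
    rw [exteriorPower.map_apply_ιMulti]
    rfl
  rw [wedge]
  generalize exteriorPower.ιMulti ℂ n v = x at h
  induction h using Submodule.span_induction with
  | mem x hx =>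
    obtain ⟨s, rfl⟩ := hx
    rw [← wedgeFinset_eq]
    exact Submodule.subset_span ⟨_, rfl⟩
  | zero =>
    rw [UniformSpace.Completion.coe_zero, lp.single_zero]
    exact Submodule.zero_mem _
  | add x y _ _ hx hy =>
    rw [UniformSpace.Completion.coe_add, lp.single_add]
    exact Submodule.add_mem _ hx hy
  | smul c x _ hx =>
    rw [UniformSpace.Completion.coe_smul, lp.single_smul]
    exact Submodule.smul_mem _ c hx

theorem dense_span_wedgeFinset (b : HilbertBasis ι ℂ H) :
    ⊤ ≤ (Submodule.span ℂ (Set.range (wedgeFinset b))).topologicalClosure := by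
  rw [← Submodule.dense_iff_topologicalClosure_eq_top.mp dense_span_wedge]
  refine Submodule.topologicalClosure_minimal _ (Submodule.span_le.mpr ?_)
    (Submodule.isClosed_topologicalClosure _)
  rintro _ ⟨n, v, rfl⟩
  -- Tuples from the span of `b` are dense among all tuples, and `wedge` is continuous, so it
  -- suffices to treat such tuples.
  have hd : Dense (Set.univ.pi fun _ : Fin n => (Submodule.span ℂ (Set.range b) : Set H)) :=
    dense_pi _ fun _ _ => Submodule.dense_iff_topologicalClosure_eq_top.mpr b.dense_span
  refine (continuous_wedge n).closure_preimage_subset _ (closure_mono ?_ (hd v))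
  exact fun w hw => wedge_mem_of_mem_span fun i => hw i trivial

/-- The Hilbert basis of Fock space made of the wedge products of elements of a Hilbert basis. -/
def wedgeBasis (b : HilbertBasis ι ℂ H) : HilbertBasis (Finset ι) ℂ (Fock H) :=
  .mk (orthonormal_wedgeFinset b.orthonormal) (dense_span_wedgeFinset b)

theorem coe_wedgeBasis (b : HilbertBasis ι ℂ H) : ⇑(wedgeBasis b) = wedgeFinset b :=
  HilbertBasis.coe_mk _ _

/-- An operator acting diagonally on the wedge basis is a second quantization. -/
theorem isSecondQuantization_of_diagonal [CompleteSpace H] {b : HilbertBasis ι ℂ H} {l : ι → ℝ}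
    {T : H →L[ℂ] H} (hT : ∀ i, T (b i) = (l i : ℂ) • b i) {R : Fock H →L[ℂ] Fock H}
    (hR : ∀ s, R (wedgeBasis b s) = ((∏ i ∈ s, l i : ℝ) : ℂ) • wedgeBasis b s) :
    IsSecondQuantization T R := by
  intro n v
  refine eq_of_inner_hilbertBasis (wedgeBasis b) fun s => ?_
  rw [inner_apply_of_diagonal hR, coe_wedgeBasis]
  by_cases h : s.card = n
  · subst h
    rw [wedgeFinset, inner_wedge_wedge, inner_wedge_wedge]
    -- Passing from `v` to `T v` multiplies row `i` of the Gram matrix by the corresponding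
    -- eigenvalue, so the determinant picks up their product.
    simp_rw [inner_apply_of_diagonal hT]
    rw [← Finset.prod_coe_sort, ← (s.orderIsoOfFin rfl).toEquiv.prod_comp, Complex.ofReal_prod]
    exact (Matrix.det_mul_column _ _).symm
  · rw [wedgeFinset, inner_wedge_wedge_of_ne h, inner_wedge_wedge_of_ne h, mul_zero]

end WedgeBasis

/-! ### Construction of diagonal operators -/

section DiagonalOperator

variable {K : Type*} [NormedAddCommGroup K] [InnerProductSpace ℂ K] [CompleteSpace K]

/-- Summability makes the series of rank-one projections weighted by `μ` converge absolutely in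
operator norm. -/
theorem exists_diagonal {ι : Type*} (c : HilbertBasis ι ℂ K) {μ : ι → ℝ} (h : Summable μ) :
    ∃ A : K →L[ℂ] K, ∀ i, A (c i) = (μ i : ℂ) • c i := by
  have hs : Summable fun i => (μ i : ℂ) • InnerProductSpace.rankOne ℂ (c i) (c i) := by
    refine Summable.of_norm (h.norm.congr fun i => ?_)
    simp [norm_smul, c.orthonormal.norm_eq_one]
  refine ⟨∑' i, (μ i : ℂ) • InnerProductSpace.rankOne ℂ (c i) (c i), fun j => ?_⟩
  have h1 := hs.hasSum.mapL (ContinuousLinearMap.apply ℂ K (c j))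
  refine h1.unique ?_
  have h2 := hasSum_single (L := .unconditional ι) (f := fun i => ContinuousLinearMap.apply ℂ K (c j)
    ((μ i : ℂ) • InnerProductSpace.rankOne ℂ (c i) (c i))) j fun i hi => by
      simp [c.orthonormal.inner_eq_zero hi]
  simpa [c.orthonormal.norm_eq_one] using h2

end DiagonalOperator

/-! ### Entropy of the product measure on finite sets -/

section Entropy

variable {ι : Type*} {l : ι → ℝ}

open Classical in
/-- Summing over the finite sets containing `i` or not containing `i`. -/
theorem tsum_finset_insert (i : ι) (w : Finset ι → ℝ≥0∞) :
    ∑' s, w s = ∑' s, (if i ∈ s then 0 else w s) + ∑' s, (if i ∈ s then 0 else w (insert i s)) := by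
  have h : ∑' s, (if i ∈ s then 0 else w (insert i s)) = ∑' s, (if i ∈ s then w s else 0) := by
    let e : {s : Finset ι // i ∉ s} ≃ {s : Finset ι // i ∈ s} :=
      { toFun := fun s => ⟨insert i s.1, Finset.mem_insert_self _ _⟩
        invFun := fun s => ⟨s.1.erase i, Finset.notMem_erase _ _⟩
        left_inv := fun s => Subtype.ext (Finset.erase_insert s.2)
        right_inv := fun s => Subtype.ext (Finset.insert_erase s.2) }
    have h1 : ∑' s, (if i ∈ s then 0 else w (insert i s)) =
        ∑' s : {s : Finset ι // i ∉ s}, w (insert i s.1) := by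
      refine Eq.trans ?_ (tsum_subtype {s : Finset ι | i ∉ s} fun s => w (insert i s)).symm
      refine tsum_congr fun s => ?_
      by_cases hs : i ∈ s <;> simp [hs, Set.indicator]
    have h2 : ∑' s, (if i ∈ s then w s else 0) = ∑' s : {s : Finset ι // i ∈ s}, w s.1 := by
      refine Eq.trans ?_ (tsum_subtype {s : Finset ι | i ∈ s} w).symm
      refine tsum_congr fun s => ?_
      by_cases hs : i ∈ s <;> simp [hs, Set.indicator]
    rw [h1, h2, ← e.tsum_eq]
    rfl
  rw [h, ← ENNReal.tsum_add]
  refine tsum_congr fun s => ?_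
  split_ifs <;> simp

/-- Expand the infinite product: each finite set records the factors from which `l i` rather than
`1` is chosen. -/
theorem tsum_ofReal_prod (hl : ∀ i, 0 ≤ l i) (hs : Summable l) :
    ∑' s : Finset ι, ENNReal.ofReal (∏ i ∈ s, l i) = ENNReal.ofReal (∏' i, (1 + l i)) := by
  have h := summable_finsetProd_of_summable_nonneg hl hs
  rw [tprod_one_add h, ENNReal.ofReal_tsum_of_nonneg (fun s => Finset.prod_nonneg fun i _ => hl i) h]

theorem log_tprod_one_add (hl : ∀ i, 0 ≤ l i) (hs : Summable l) :
    0 < ∏' i, (1 + l i) ∧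
      HasSum (fun i => Real.log (1 + l i)) (Real.log (∏' i, (1 + l i))) := by
  have h := Real.summable_log_one_add_of_summable hs
  rw [← Real.rexp_tsum_eq_tprod (fun i => by have := hl i; positivity) h, Real.log_exp]
  exact ⟨Real.exp_pos _, h.hasSum⟩

open Classical in
/-- With `p = ∏_{i ∈ s} l i / ∏ (1 + l i)`, the quantity `- log p` as a sum of nonnegative terms. -/
theorem ofReal_negMulLog_prod_div (hl : ∀ i, 0 ≤ l i) (hs : Summable l) (s : Finset ι) :
    ENNReal.ofReal (Real.negMulLog ((∏' i, (1 + l i))⁻¹ * ∏ i ∈ s, l i)) =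
      ∑' i, ENNReal.ofReal ((∏' i, (1 + l i))⁻¹ * ∏ i ∈ s, l i) *
        ENNReal.ofReal (Real.log (1 + l i) - if i ∈ s then Real.log (l i) else 0) := by
  obtain ⟨hZ, hlog⟩ := log_tprod_one_add hl hs
  set Z := ∏' i, (1 + l i)
  rw [ENNReal.tsum_mul_left]
  -- A set of weight zero contributes `0` on both sides; otherwise every logarithm below has a
  -- positive argument.
  by_cases h0 : ∏ i ∈ s, l i = 0
  · simp [h0]
  have hpos : ∀ i ∈ s, 0 < l i := fun i hi =>
    lt_of_le_of_ne (hl i) fun h => h0 (Finset.prod_eq_zero hi h.symm)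
  have hsum : HasSum (fun i => Real.log (1 + l i) - if i ∈ s then Real.log (l i) else 0)
      (Real.log Z - ∑ i ∈ s, Real.log (l i)) := by
    refine hlog.sub ?_
    have := hasSum_sum_of_ne_finset_zero (f := fun i => if i ∈ s then Real.log (l i) else 0)
      (s := s) (L := .unconditional ι) (fun i hi => if_neg hi)
    rwa [Finset.sum_congr rfl fun i hi => if_pos hi] at this
  -- Since `l i ≤ 1 + l i`, no term is negative, so `ENNReal.ofReal` truncates nothing.
  have hnn : ∀ i, 0 ≤ Real.log (1 + l i) - if i ∈ s then Real.log (l i) else 0 := by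
    intro i
    split_ifs with hi
    · exact sub_nonneg.mpr (Real.log_le_log (hpos i hi) (by linarith))
    · rw [sub_zero]
      exact Real.log_nonneg (by linarith [hl i])
  rw [← ENNReal.ofReal_tsum_of_nonneg hnn hsum.summable, hsum.tsum_eq, ← ENNReal.ofReal_mul
    (mul_nonneg (inv_nonneg.mpr hZ.le) (Finset.prod_nonneg fun i _ => hl i)), Real.negMulLog,
    Real.log_mul (inv_ne_zero hZ.ne') h0, Real.log_inv, Real.log_prod (fun i hi => (hpos i hi).ne')]
  congr 1
  ring

/-- The entropy of the product measure on finite sets with odds `l`. -/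
theorem tsum_negMulLog_prod (hl : ∀ i, 0 ≤ l i) (hs : Summable l) :
    ∑' s : Finset ι, ENNReal.ofReal (Real.negMulLog ((∏' i, (1 + l i))⁻¹ * ∏ i ∈ s, l i)) =
      ∑' i, ENNReal.ofReal (entropyFn (l i)) := by
  classical
  obtain ⟨hZ, -⟩ := log_tprod_one_add hl hs
  have hZsum := tsum_ofReal_prod hl hs
  simp_rw [ofReal_negMulLog_prod_div hl hs]
  set Z := ∏' i, (1 + l i)
  rw [ENNReal.tsum_comm]
  refine tsum_congr fun i => ?_
  have hnn : ∀ s : Finset ι, 0 ≤ ∏ j ∈ s, l j := fun s => Finset.prod_nonneg fun j _ => hl j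
  have hZi : 0 ≤ Z⁻¹ := inv_nonneg.mpr hZ.le
  have h1 : (0 : ℝ) < 1 + l i := by linarith [hl i]
  -- the probability of the sets not containing `i`
  set q : ℝ≥0∞ := ∑' s : Finset ι, if i ∈ s then 0 else ENNReal.ofReal (Z⁻¹ * ∏ j ∈ s, l j) with hq
  have hins : ∀ s : Finset ι, i ∉ s → ENNReal.ofReal (Z⁻¹ * ∏ j ∈ insert i s, l j) =
      ENNReal.ofReal (l i) * ENNReal.ofReal (Z⁻¹ * ∏ j ∈ s, l j) := by
    intro s hi
    rw [Finset.prod_insert hi, ← ENNReal.ofReal_mul (hl i)]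
    congr 1
    ring
  -- Inserting `i` multiplies the weight by `l i`, so the total mass is `1 = q + l i * q`.
  have hq1 : q * ENNReal.ofReal (1 + l i) = 1 := by
    have h := tsum_finset_insert i fun s : Finset ι => ENNReal.ofReal (Z⁻¹ * ∏ j ∈ s, l j)
    have hl1 : ∑' s : Finset ι, ENNReal.ofReal (Z⁻¹ * ∏ j ∈ s, l j) = 1 := by
      simp_rw [ENNReal.ofReal_mul hZi]
      rw [ENNReal.tsum_mul_left, hZsum, ← ENNReal.ofReal_mul hZi, inv_mul_cancel₀ hZ.ne',
        ENNReal.ofReal_one]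
    rw [hl1, ← hq] at h
    rw [ENNReal.ofReal_add zero_le_one (hl i), ENNReal.ofReal_one, mul_add, mul_one, h, hq,
      mul_comm, ← ENNReal.tsum_mul_left]
    congr 1
    refine tsum_congr fun s => ?_
    split_ifs with hi
    · simp
    · rw [hins s hi]
  have hqv : q = ENNReal.ofReal (1 + l i)⁻¹ := by
    rw [ENNReal.ofReal_inv_of_pos h1]
    exact ENNReal.eq_inv_of_mul_eq_one_left hq1
  -- Once the sets are split by whether they contain `i`, the logarithmic factor is constant on each
  -- half.
  rw [tsum_finset_insert i]
  have e1 : ∑' s : Finset ι, (if i ∈ s then 0 else ENNReal.ofReal (Z⁻¹ * ∏ j ∈ s, l j) *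
      ENNReal.ofReal (Real.log (1 + l i) - if i ∈ s then Real.log (l i) else 0)) =
      q * ENNReal.ofReal (Real.log (1 + l i)) := by
    rw [hq, ← ENNReal.tsum_mul_right]
    refine tsum_congr fun s => ?_
    split_ifs <;> simp
  have e2 : ∑' s : Finset ι, (if i ∈ s then 0 else ENNReal.ofReal (Z⁻¹ * ∏ j ∈ insert i s, l j) *
      ENNReal.ofReal (Real.log (1 + l i) - if i ∈ insert i s then Real.log (l i) else 0)) =
      q * (ENNReal.ofReal (l i) * ENNReal.ofReal (Real.log (1 + l i) - Real.log (l i))) := by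
    rw [hq, ← ENNReal.tsum_mul_right]
    refine tsum_congr fun s => ?_
    split_ifs with hi h'
    · simp
    · rw [hins s hi]; ring
    · exact absurd (Finset.mem_insert_self i s) h'
  rw [e1, e2, ← mul_add, hqv]
  have hlog : 0 ≤ Real.log (1 + l i) := Real.log_nonneg (by linarith [hl i])
  -- For `l i = 0` the prefactor vanishes, so the logarithms need no comparison.
  have hlog' : 0 ≤ l i * (Real.log (1 + l i) - Real.log (l i)) := by
    rcases (hl i).eq_or_lt with h | h
    · simp [← h]
    · exact mul_nonneg h.le (sub_nonneg.mpr (Real.log_le_log h (by linarith)))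
  rw [← ENNReal.ofReal_mul (hl i), ← ENNReal.ofReal_add hlog hlog',
    ← ENNReal.ofReal_mul (inv_nonneg.mpr h1.le), entropyFn]
  congr 1
  field_simp
  ring

end Entropy

end FermionicFock

end

/-! ### The entropy formula -/

theorem mainTheorem6 {H : Type*} [NormedAddCommGroup H] [InnerProductSpace ℂ H] [CompleteSpace H]
    (T : H →L[ℂ] H) (hT : T.IsPositive) (hT_trace : FermionicFock.IsTraceClass T) :
    FermionicFock.IsSecondQuantization T (FermionicFock.secondQuantization T) ∧
      (FermionicFock.secondQuantization T).IsPositive ∧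
      FermionicFock.IsTraceClass (FermionicFock.secondQuantization T) ∧
      FermionicFock.trace (FermionicFock.secondQuantization T) ≠ 0 ∧
      ∃ ρ : FermionicFock.DensityMatrix (FermionicFock.Fock H),
        ρ.op = (FermionicFock.trace (FermionicFock.secondQuantization T))⁻¹ •
          FermionicFock.secondQuantization T ∧
        FermionicFock.vonNeumannEntropy ρ.state =
          FermionicFock.posTrace (cfc FermionicFock.entropyFn T) := by
  open FermionicFock in
  have hT0 : 0 ≤ T := (ContinuousLinearMap.nonneg_iff_isPositive T).mpr hT
  obtain ⟨ι, b, l, hTb, hl⟩ :=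
    exists_hilbertBasis_eigenvectors hT0 (isCompactOperator_of_isTraceClass hT0 hT_trace)
  classical
  -- Any linear order will do: it only fixes the signs of the basis wedges.
  let _ : LinearOrder ι := linearOrderOfSTO (WellOrderingRel (α := ι))
  have hls : Summable l := by
    rw [isTraceClass_iff_of_nonneg hT0, posTrace_of_diagonal hTb hl] at hT_trace
    refine (ENNReal.summable_toReal hT_trace.ne).congr fun i => ENNReal.toReal_ofReal (hl i)
  have hprod : ∀ s : Finset ι, 0 ≤ ∏ i ∈ s, l i := fun s => Finset.prod_nonneg fun i _ => hl i
  obtain ⟨R, hR⟩ := exists_diagonal (wedgeBasis b) (summable_finsetProd_of_summable_nonneg hl hls)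
  have hsq : IsSecondQuantization T R := isSecondQuantization_of_diagonal hTb hR
  -- Wedges span a dense subspace, so the diagonal operator `R` is the only candidate for `⋀T`.
  rw [secondQuantization_eq hsq]
  have hR0 : 0 ≤ R := nonneg_of_diagonal hR hprod
  obtain ⟨hZ, -⟩ := log_tprod_one_add hl hls
  have hposR : posTrace R = ENNReal.ofReal (∏' i, (1 + l i)) := by
    rw [posTrace_of_diagonal hR hprod, tsum_ofReal_prod hl hls]
  have htrR : trace R = ((∏' i, (1 + l i) : ℝ) : ℂ) := by
    rw [trace_eq_posTrace hR0, hposR, ENNReal.toReal_ofReal hZ.le]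
  have hρ : ∀ s, ((trace R)⁻¹ • R) (wedgeBasis b s) =
      (((∏' i, (1 + l i))⁻¹ * ∏ i ∈ s, l i : ℝ) : ℂ) • wedgeBasis b s := fun s => by
    rw [smul_apply, hR, htrR, smul_smul, Complex.ofReal_mul, Complex.ofReal_inv]
  have hρ0 : ∀ s : Finset ι, 0 ≤ (∏' i, (1 + l i))⁻¹ * ∏ i ∈ s, l i := fun s =>
    mul_nonneg (inv_nonneg.mpr hZ.le) (hprod s)
  have hρtr : posTrace ((trace R)⁻¹ • R) = 1 := by
    rw [posTrace_of_diagonal hρ hρ0]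
    simp_rw [ENNReal.ofReal_mul (inv_nonneg.mpr hZ.le)]
    rw [ENNReal.tsum_mul_left, tsum_ofReal_prod hl hls, ← ENNReal.ofReal_mul
      (inv_nonneg.mpr hZ.le), inv_mul_cancel₀ hZ.ne', ENNReal.ofReal_one]
  let ρ : DensityMatrix (Fock H) := ⟨(trace R)⁻¹ • R, nonneg_of_diagonal hρ hρ0, hρtr⟩
  refine ⟨hsq, (ContinuousLinearMap.nonneg_iff_isPositive R).mp hR0, ?_, ?_, ρ, rfl, ?_⟩
  · rw [isTraceClass_iff_of_nonneg hR0, hposR]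
    exact ENNReal.ofReal_lt_top
  · rw [htrR]
    exact_mod_cast hZ.ne'
  -- Each weight is one term of a nonnegative series with sum `1`; the bound makes `Real.negMulLog`
  -- nonnegative there.
  have hle : ∀ s : Finset ι, (∏' i, (1 + l i))⁻¹ * ∏ i ∈ s, l i ≤ 1 := fun s => by
    rw [← ENNReal.ofReal_le_one, ← hρtr, posTrace_of_diagonal hρ hρ0]
    exact ENNReal.le_tsum s
  -- Continuity on the spectrum matters, since `cfc` is `0` by default otherwise; at the eigenvalue
  -- `0` it rests on the continuity of `x log x`.
  have hent : ∀ i, cfc entropyFn T (b i) = (entropyFn (l i) : ℂ) • b i := fun i =>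
    cfc_apply_of_apply_eq (IsSelfAdjoint.of_nonneg hT0)
      (entropyFn_continuousOn.mono fun _ hx => spectrum_nonneg_of_nonneg hT0 hx) (hTb i)
  have hneg : ∀ s, ρ.negMulLog (wedgeBasis b s) =
      (Real.negMulLog ((∏' i, (1 + l i))⁻¹ * ∏ i ∈ s, l i) : ℂ) • wedgeBasis b s := fun s =>
    cfc_apply_of_apply_eq (IsSelfAdjoint.of_nonneg ρ.nonneg)
      Real.continuous_negMulLog.continuousOn (hρ s)
  rw [vonNeumannEntropy_state, posTrace_of_diagonal hent fun i => entropyFn_nonneg (hl i),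
    posTrace_of_diagonal hneg fun s => Real.negMulLog_nonneg (hρ0 s) (hle s),
    tsum_negMulLog_prod hl hls]
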